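/- Let $\mathbb F$ be a division ring, let $n\ge 1$, and let $\mathbb F[z]$ be the ring of polynomials in a variable $z$ commuting with the coefficients. Let $A\in\mathbb F^{n\times n}$. A column $v\in\mathbb F^{n\times 1}$ is a \emph{right cyclic vector} of $A$ (the pair $(A,v)$ is controllable) if the matrix $[\,v\ \ Av\ \cdots\ A^{n-1}v\,]$ is invertible; a row $u\in\mathbb F^{1\times n}$ is a \emph{left cyclic vector} of $A$ (the pair $(u,A)$ is observable) if the matrix with rows $u,uA,\dots,uA^{n-1}$ is invertible. For a column $v$, the polynomial $\mathfrak P_{A,v}$ is the monic generator of the right ideal $\{\sum_j f_jz^j:\ \sum_j A^jvf_j=0\}$ of $\mathbb F[z]$; for a row $u$, the polynomial $\mathfrak P_{u,A}$ is the monic generator of the left ideal $\{\sum_j f_jz^j:\ \sum_j f_juA^j=0\}$. For a monic $p=z^n+\sum_{k<n}p_kz^k$ the left companion matrix is $$C_\ell(p)=\begin{bmatrix}0&0&\cdots&0&-p_0\\1&0&\cdots&0&-p_1\\0&1&\cdots&0&-p_2\\ \vdots&&\ddots&&\vdots\\0&0&\cdots&1&-p_{n-1}\end{bmatrix},$$ and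 the right companion matrix is its transpose $C_r(p)=C_\ell(p)^\top$. Write $A\sim B$ if $A=TBT^{-1}$ for some invertible $T\in\mathbb F^{n\times n}$, and call $M,N\in\mathbb F[z]^{n\times n}$ equivalent if $N=UMV$ with $U,V$ invertible over $\mathbb F[z]$. Let $e_1$ be the first column of the identity matrix $I_n$. The following are equivalent: (1) $A$ has a right cyclic vector; (2) $A$ has a left cyclic vector; (3) $A\sim C_\ell(f)$ or $A\sim C_r(f)$ for some monic $f\in\mathbb F[z]$ of degree $n$; (4) $zI_n-A$ is equivalent to $\operatorname{diag}(I_{n-1},h)$ for some $h\in\mathbb F[z]$. If this is the case, then: (a) for all right cyclic vectors $v$ and all left cyclic vectors $u$ of $A$, the polynomials $\mathfrak P_{A,v}$ and $\mathfrak P_{u,A}$ have degree $n$ and $A\sim C_\ell(\mathfrak P_{A,v})\sim C_r(\mathfrak P_{u,A})$. (b) If $f$ is monic of degree $n$ and $A=TC_\ell(f)T^{-1}$ with $T$ invertible, then $v=Te_1$ is a right cyclic vector of $A$ and $f=\mathfrak P_{A,v}$. If $g$ is monic of degree $n$ and $A=SC_r(g)S^{-1}$ with $S$ invertible, then $u=e_1^\top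 S^{-1}$ is a left cyclic vector of $A$ and $g=\mathfrak P_{u,A}$. (c) If $h$ is as in (4), then there is a right cyclic vector $w$ of $A$ such that $h=\mathfrak P_{A,w}\,c$, where $c\in\mathbb F$ is the leading coefficient of $h$; in particular, $h=\mathfrak P_{A,w}$ if $h$ is monic. -/

import Mathlib

open Matrix Polynomial

namespace DivisionRingCyclic

variable {F : Type*} [DivisionRing F] {n : ℕ}

/-- Controllability matrix with columns `v, A v, …, A ^ (n - 1) v`. -/
def controllabilityMatrix (A : Matrix (Fin n) (Fin n) F) (v : Fin n → F) :
    Matrix (Fin n) (Fin n) F :=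
  Matrix.of fun i j => ((A ^ (j : ℕ)) *ᵥ v) i

/-- Observability matrix with rows `u, u A, …, u A ^ (n - 1)`. -/
def observabilityMatrix (u : Fin n → F) (A : Matrix (Fin n) (Fin n) F) :
    Matrix (Fin n) (Fin n) F :=
  Matrix.of fun i j => (u ᵥ* (A ^ (i : ℕ))) j

/-- The input pair `(A, v)` is controllable, that is, `v` is a right cyclic vector of `A`. -/
def IsControllable (A : Matrix (Fin n) (Fin n) F) (v : Fin n → F) : Prop :=
  IsUnit (controllabilityMatrix A v)

/-- The output pair `(u, A)` is observable, that is, `u` is a left cyclic vector of `A`. -/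
def IsObservable (u : Fin n → F) (A : Matrix (Fin n) (Fin n) F) : Prop :=
  IsUnit (observabilityMatrix u A)

/-- Left evaluation of `v f` at `A`: the column `∑ j, A ^ j v f_j` (coefficients on the right). -/
def leftEval (A : Matrix (Fin n) (Fin n) F) (v : Fin n → F) (f : F[X]) : Fin n → F :=
  fun i => f.sum fun j c => ((A ^ j) *ᵥ v) i * c

/-- Right evaluation of `f u` at `A`: the row `∑ j, f_j u A ^ j` (coefficients on the left). -/
def rightEval (u : Fin n → F) (A : Matrix (Fin n) (Fin n) F) (f : F[X]) : Fin n → F :=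
  fun i => f.sum fun j c => c * (u ᵥ* (A ^ j)) i

theorem leftEval_zero (A : Matrix (Fin n) (Fin n) F) (v : Fin n → F) : leftEval A v 0 = 0 := by
  funext i
  simp [leftEval]

theorem leftEval_add (A : Matrix (Fin n) (Fin n) F) (v : Fin n → F) (f g : F[X]) :
    leftEval A v (f + g) = leftEval A v f + leftEval A v g := by
  funext i
  simp only [leftEval, Pi.add_apply]
  exact Polynomial.sum_add_index f g _ (by simp) (by intros; rw [mul_add])

theorem leftEval_monomial (A : Matrix (Fin n) (Fin n) F) (v : Fin n → F) (k : ℕ) (c : F)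
    (i : Fin n) : leftEval A v (monomial k c) i = ((A ^ k) *ᵥ v) i * c := by
  simp [leftEval, Polynomial.sum_monomial_index]

theorem leftEval_mul_monomial (A : Matrix (Fin n) (Fin n) F) (v : Fin n → F) (f : F[X])
    (k : ℕ) (c : F) (i : Fin n) :
    leftEval A v (f * monomial k c) i = ((A ^ k) *ᵥ (leftEval A v f)) i * c := by
  induction f using Polynomial.induction_on' with
  | add p q hp hq =>
    rw [add_mul, leftEval_add, leftEval_add, Matrix.mulVec_add]
    simp only [Pi.add_apply, hp, hq, add_mul]
  | monomial m a =>
    have h : leftEval A v (monomial m a) = fun l => ((A ^ m) *ᵥ v) l * a := by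
      funext l
      exact leftEval_monomial A v m a l
    rw [monomial_mul_monomial, leftEval_monomial, h, add_comm m k, pow_add,
      ← Matrix.mulVec_mulVec]
    simp only [Matrix.mulVec, dotProduct, Finset.sum_mul, mul_assoc]

theorem rightEval_zero (u : Fin n → F) (A : Matrix (Fin n) (Fin n) F) : rightEval u A 0 = 0 := by
  funext i
  simp [rightEval]

theorem rightEval_add (u : Fin n → F) (A : Matrix (Fin n) (Fin n) F) (f g : F[X]) :
    rightEval u A (f + g) = rightEval u A f + rightEval u A g := by
  funext i
  simp only [rightEval, Pi.add_apply]
  exact Polynomial.sum_add_index f g _ (by simp) (by intros; rw [add_mul])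

theorem rightEval_monomial (u : Fin n → F) (A : Matrix (Fin n) (Fin n) F) (k : ℕ) (c : F)
    (i : Fin n) : rightEval u A (monomial k c) i = c * (u ᵥ* (A ^ k)) i := by
  simp [rightEval, Polynomial.sum_monomial_index]

theorem rightEval_monomial_mul (u : Fin n → F) (A : Matrix (Fin n) (Fin n) F) (f : F[X])
    (k : ℕ) (c : F) (i : Fin n) :
    rightEval u A (monomial k c * f) i = c * ((rightEval u A f) ᵥ* (A ^ k)) i := by
  induction f using Polynomial.induction_on' with
  | add p q hp hq =>
    rw [mul_add, rightEval_add, rightEval_add, Matrix.add_vecMul]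
    simp only [Pi.add_apply, hp, hq, mul_add]
  | monomial m a =>
    have h : rightEval u A (monomial m a) = fun l => a * (u ᵥ* (A ^ m)) l := by
      funext l
      exact rightEval_monomial u A m a l
    rw [monomial_mul_monomial, rightEval_monomial, h, add_comm k m, pow_add,
      ← Matrix.vecMul_vecMul]
    have h2 : ∀ w : Fin n → F, (fun l => a * w l) = a • w := fun w => rfl
    rw [h2, Matrix.smul_vecMul, Pi.smul_apply, smul_eq_mul, mul_assoc]

/-- The right ideal `I_{A,v}` of all `p` with left evaluation of `v p` at `A` equal to zero. -/
def inputAnnihilator (A : Matrix (Fin n) (Fin n) F) (v : Fin n → F) : Set F[X] :=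
  {p | leftEval A v p = 0}

/-- The left ideal `I_{u,A}` of all `p` with right evaluation of `p u` at `A` equal to zero. -/
def outputAnnihilator (u : Fin n → F) (A : Matrix (Fin n) (Fin n) F) : Set F[X] :=
  {p | rightEval u A p = 0}

theorem exists_ne_zero_mem_inputAnnihilator (A : Matrix (Fin n) (Fin n) F) (v : Fin n → F) :
    ∃ p ∈ inputAnnihilator A v, p ≠ 0 := by
  have hdep : ¬ LinearIndependent Fᵐᵒᵖ
      (fun j : Fin (n + 1) => fun i : Fin n => MulOpposite.op (((A ^ (j : ℕ)) *ᵥ v) i)) := by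
    intro h
    have := h.fintype_card_le_finrank
    simp at this
  obtain ⟨g, hg, j, hj⟩ := Fintype.not_linearIndependent_iff.1 hdep
  have hev : ∀ s : Finset (Fin (n + 1)), ∀ i,
      leftEval A v (∑ j ∈ s, monomial (j : ℕ) (g j).unop) i
        = ∑ j ∈ s, ((A ^ (j : ℕ)) *ᵥ v) i * (g j).unop := by
    intro s i
    induction s using Finset.induction_on with
    | empty => simp [leftEval_zero]
    | insert a s ha ih =>
      rw [Finset.sum_insert ha, Finset.sum_insert ha, leftEval_add, Pi.add_apply, ih,
        leftEval_monomial]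
  refine ⟨∑ j : Fin (n + 1), monomial (j : ℕ) (g j).unop, ?_, ?_⟩
  · funext i
    rw [hev]
    have := congrFun hg i
    simp only [Finset.sum_apply, Pi.smul_apply, smul_eq_mul, Pi.zero_apply] at this
    have h2 := congrArg MulOpposite.unop this
    simpa using h2
  · intro h0
    apply hj
    have := congrArg (fun p : F[X] => p.coeff (j : ℕ)) h0
    simp only [finsetSum_coeff, coeff_monomial, coeff_zero, Fin.val_inj] at this
    simpa using this

theorem exists_ne_zero_mem_outputAnnihilator (u : Fin n → F) (A : Matrix (Fin n) (Fin n) F) :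
    ∃ p ∈ outputAnnihilator u A, p ≠ 0 := by
  have hdep : ¬ LinearIndependent F (fun j : Fin (n + 1) => u ᵥ* (A ^ (j : ℕ))) := by
    intro h
    have := h.fintype_card_le_finrank
    simp at this
  obtain ⟨g, hg, j, hj⟩ := Fintype.not_linearIndependent_iff.1 hdep
  have hev : ∀ s : Finset (Fin (n + 1)), ∀ i,
      rightEval u A (∑ j ∈ s, monomial (j : ℕ) (g j)) i
        = ∑ j ∈ s, g j * (u ᵥ* (A ^ (j : ℕ))) i := by
    intro s i
    induction s using Finset.induction_on with
    | empty => simp [rightEval_zero]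
    | insert a s ha ih =>
      rw [Finset.sum_insert ha, Finset.sum_insert ha, rightEval_add, Pi.add_apply, ih,
        rightEval_monomial]
  refine ⟨∑ j : Fin (n + 1), monomial (j : ℕ) (g j), ?_, ?_⟩
  · funext i
    rw [hev]
    have := congrFun hg i
    simpa only [Finset.sum_apply, Pi.smul_apply, smul_eq_mul, Pi.zero_apply] using this
  · intro h0
    apply hj
    have := congrArg (fun p : F[X] => p.coeff (j : ℕ)) h0
    simp only [finsetSum_coeff, coeff_monomial, coeff_zero, Fin.val_inj] at this
    simpa using this

theorem exists_monic_generator_input (A : Matrix (Fin n) (Fin n) F) (v : Fin n → F) :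
    ∃ p : F[X], p.Monic ∧ inputAnnihilator A v = {q | ∃ g, q = p * g} := by
  classical
  have hmul : ∀ p ∈ inputAnnihilator A v, ∀ g, p * g ∈ inputAnnihilator A v := by
    intro p hp g
    induction g using Polynomial.induction_on' with
    | add a b ha hb =>
      change leftEval A v _ = 0
      rw [mul_add, leftEval_add]
      rw [show leftEval A v (p * a) = 0 from ha, show leftEval A v (p * b) = 0 from hb, add_zero]
    | monomial k c =>
      funext i
      rw [leftEval_mul_monomial, show leftEval A v p = 0 from hp]
      simp
  have hex : ∃ d, ∃ p ∈ inputAnnihilator A v, p ≠ 0 ∧ p.natDegree = d := by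
    obtain ⟨p, hp, h0⟩ := exists_ne_zero_mem_inputAnnihilator A v
    exact ⟨_, p, hp, h0, rfl⟩
  obtain ⟨p₀, hp₀, h₀, hd⟩ := Nat.find_spec hex
  have hmin : ∀ q ∈ inputAnnihilator A v, q ≠ 0 → p₀.natDegree ≤ q.natDegree := by
    intro q hq hq0
    rw [hd]
    exact Nat.find_min' hex ⟨q, hq, hq0, rfl⟩
  have hlc : p₀.leadingCoeff ≠ 0 := leadingCoeff_ne_zero.2 h₀
  have hmon : (p₀ * C p₀.leadingCoeff⁻¹).Monic := monic_mul_leadingCoeff_inv h₀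
  have hdeg : (p₀ * C p₀.leadingCoeff⁻¹).natDegree = p₀.natDegree :=
    natDegree_mul_C (inv_ne_zero hlc)
  have hpI := hmul p₀ hp₀ (C p₀.leadingCoeff⁻¹)
  generalize p₀ * C p₀.leadingCoeff⁻¹ = p at hmon hdeg hpI
  refine ⟨p, hmon, Set.ext fun q => ⟨fun hq => ⟨q /ₘ p, ?_⟩, ?_⟩⟩
  · have hdiv := modByMonic_add_div q p
    have hr : leftEval A v (q %ₘ p) = 0 := by
      have h1 : leftEval A v q = 0 := hq
      rw [← hdiv, leftEval_add, show leftEval A v (p * (q /ₘ p)) = 0 from hmul p hpI _,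
        add_zero] at h1
      exact h1
    have hr0 : q %ₘ p = 0 := by
      by_contra hne
      have h1 := hmin _ hr hne
      have h2 := degree_modByMonic_lt q hmon
      have h3 := natDegree_lt_natDegree hne h2
      omega
    rw [hr0, zero_add] at hdiv
    exact hdiv.symm
  · rintro ⟨g, rfl⟩
    exact hmul p hpI g

theorem exists_monic_generator_output (u : Fin n → F) (A : Matrix (Fin n) (Fin n) F) :
    ∃ p : F[X], p.Monic ∧ outputAnnihilator u A = {q | ∃ g, q = g * p} := by
  classical
  have hmul : ∀ p ∈ outputAnnihilator u A, ∀ g, g * p ∈ outputAnnihilator u A := by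
    intro p hp g
    induction g using Polynomial.induction_on' with
    | add a b ha hb =>
      change rightEval u A _ = 0
      rw [add_mul, rightEval_add]
      rw [show rightEval u A (a * p) = 0 from ha, show rightEval u A (b * p) = 0 from hb, add_zero]
    | monomial k c =>
      funext i
      rw [rightEval_monomial_mul, show rightEval u A p = 0 from hp]
      simp
  have hex : ∃ d, ∃ p ∈ outputAnnihilator u A, p ≠ 0 ∧ p.natDegree = d := by
    obtain ⟨p, hp, h0⟩ := exists_ne_zero_mem_outputAnnihilator u A
    exact ⟨_, p, hp, h0, rfl⟩
  obtain ⟨p₀, hp₀, h₀, hd⟩ := Nat.find_spec hex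
  have hmin : ∀ q ∈ outputAnnihilator u A, q ≠ 0 → p₀.natDegree ≤ q.natDegree := by
    intro q hq hq0
    rw [hd]
    exact Nat.find_min' hex ⟨q, hq, hq0, rfl⟩
  have hlc : p₀.leadingCoeff ≠ 0 := leadingCoeff_ne_zero.2 h₀
  have hmon : (C p₀.leadingCoeff⁻¹ * p₀).Monic := by
    rw [Monic, leadingCoeff_mul, leadingCoeff_C, inv_mul_cancel₀ hlc]
  have hdeg : (C p₀.leadingCoeff⁻¹ * p₀).natDegree = p₀.natDegree :=
    natDegree_C_mul (inv_ne_zero hlc)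
  have hpI := hmul p₀ hp₀ (C p₀.leadingCoeff⁻¹)
  generalize C p₀.leadingCoeff⁻¹ * p₀ = p at hmon hdeg hpI
  refine ⟨p, hmon, Set.ext fun q => ⟨fun hq => ?_, ?_⟩⟩
  · induction hN : q.natDegree using Nat.strong_induction_on generalizing q with
    | _ N ih =>
      by_cases hq0 : q = 0
      · exact ⟨0, by simp [hq0]⟩
      have hle : p.natDegree ≤ q.natDegree := hdeg ▸ hmin q hq hq0
      set t : F[X] := monomial (q.natDegree - p.natDegree) q.leadingCoeff * p with ht
      have hqlc : q.leadingCoeff ≠ 0 := leadingCoeff_ne_zero.2 hq0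
      have ht0 : t ≠ 0 := mul_ne_zero (by simpa using hqlc) hmon.ne_zero
      have htd : t.natDegree = q.natDegree := by
        rw [ht, natDegree_mul (by simpa using hqlc) hmon.ne_zero,
          natDegree_monomial_eq _ hqlc]
        omega
      have htl : t.leadingCoeff = q.leadingCoeff := by
        rw [ht, leadingCoeff_mul, leadingCoeff_monomial, hmon.leadingCoeff, mul_one]
      have hlt : (q - t).degree < q.degree :=
        degree_sub_lt_left (by rw [degree_eq_natDegree hq0, degree_eq_natDegree ht0, htd]) hq0 htl.symm
      have hqt : q - t ∈ outputAnnihilator u A := by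
        have h1 : rightEval u A (q - t) + rightEval u A t = 0 := by
          rw [← rightEval_add, sub_add_cancel]
          exact hq
        rw [show rightEval u A t = 0 from hmul p hpI _, add_zero] at h1
        exact h1
      by_cases hz : q - t = 0
      · exact ⟨_, sub_eq_zero.1 hz⟩
      · obtain ⟨g, hg⟩ := ih _ (hN ▸ natDegree_lt_natDegree hz hlt) (q - t) hqt rfl
        refine ⟨g + monomial (q.natDegree - p.natDegree) q.leadingCoeff, ?_⟩
        rw [add_mul, ← hg, ← ht, sub_add_cancel]
  · rintro ⟨g, rfl⟩
    exact hmul p hpI g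

/-- The minimal polynomial `P_{A,v}` of the input pair `(A, v)`: the monic generator of the right
ideal `I_{A,v}`. -/
noncomputable def inputMinpoly (A : Matrix (Fin n) (Fin n) F) (v : Fin n → F) : F[X] :=
  Classical.choose (exists_monic_generator_input A v)

/-- The minimal polynomial `P_{u,A}` of the output pair `(u, A)`: the monic generator of the left
ideal `I_{u,A}`. -/
noncomputable def outputMinpoly (u : Fin n → F) (A : Matrix (Fin n) (Fin n) F) : F[X] :=
  Classical.choose (exists_monic_generator_output u A)

/-- The left companion matrix of a monic polynomial `p = z ^ n + ∑ k < n, p_k z ^ k` of degree `n`: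
ones below the diagonal, last column `-p_0, …, -p_(n-1)`. -/
def leftCompanion (n : ℕ) (p : F[X]) : Matrix (Fin n) (Fin n) F :=
  Matrix.of fun i j =>
    if (j : ℕ) + 1 = n then -p.coeff i else if (i : ℕ) = (j : ℕ) + 1 then 1 else 0

/-- The right companion matrix: the transpose of the left one. -/
def rightCompanion (n : ℕ) (p : F[X]) : Matrix (Fin n) (Fin n) F :=
  (leftCompanion n p)ᵀ

/-- Similarity of square matrices. -/
def MatrixSimilar (A B : Matrix (Fin n) (Fin n) F) : Prop :=
  ∃ T : (Matrix (Fin n) (Fin n) F)ˣ, A = T.val * B * T⁻¹.val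

/-- The pencil `z I - A`. -/
noncomputable def pencil (A : Matrix (Fin n) (Fin n) F) : Matrix (Fin n) (Fin n) F[X] :=
  Matrix.diagonal (fun _ => (X : F[X])) - A.map C

/-- The polynomial matrix `diag (1, …, 1, h)`. -/
noncomputable def diagOnesLast (n : ℕ) (h : F[X]) : Matrix (Fin n) (Fin n) F[X] :=
  Matrix.diagonal fun i => if (i : ℕ) + 1 = n then h else 1

/-- Equivalence of polynomial matrices: multiplication on both sides by matrices invertible over
the polynomial ring. -/
def PolyMatrixEquivalent (M N : Matrix (Fin n) (Fin n) F[X]) : Prop :=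
  ∃ U V : (Matrix (Fin n) (Fin n) F[X])ˣ, U.val * M * V.val = N

end DivisionRingCyclic

open DivisionRingCyclic

/-!
No characteristic polynomial is available over a division ring; its role is played by the right
`F[X]`-module `F^n`, on which `z` acts as `A` and scalars act on the right.

A column `v` is right cyclic exactly when its controllability matrix `K` is invertible. Since `A`
shifts the columns of `K`, the annihilation of `v` by a monic `f` of degree `n` amounts to
`A K = K C_ℓ(f)` (`mul_controllabilityMatrix`). Conversely every `K` with `A K = K C_ℓ(f)` is the
controllability matrix of its first column (`controllabilityMatrix_of_mul_eq`). So right cyclic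
vectors are the same as similarities with left companion matrices. The statements on rows are those
on columns over `Fᵐᵒᵖ`, by the anti-isomorphism `transposeOp`.

Left and right companion matrices are linked by the Hankel matrix `H = (f_(i + j + 1))`: the
classical identity `C_ℓ(f) H = H C_r(f)` holds without commutativity, because every product of
entries in it has a factor `0` or `1` (`leftCompanion_mul_hankel`), and `H` is invertible. Hence a
matrix has a right cyclic vector if and only if it has a left one.

Horner's scheme diagonalizes the pencil of a companion matrix
(`polyMatrixEquivalent_pencil_leftCompanion`). For the converse, evaluation at `A` identifies the
cokernel of `zI - A` with `F^n` (`exists_pencil_mulVec_add`). If `zI - A` is equivalent to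
`diag (1, …, 1, h)`, this cokernel is `F[X] / h F[X]`, and the image `w` of its generator is a
cyclic vector with annihilator `h F[X]` (`exists_isControllable_of_equivalent`). Thus `h` and the minimal
polynomial of `w` generate the same right ideal, and differ by a constant factor.
-/

namespace DivisionRingCyclic

open MulOpposite

variable {F : Type*} [DivisionRing F] {n : ℕ}

/-! ### Invertible matrices over a division ring -/

theorem isUnit_of_mulVec_surjective {M : Matrix (Fin n) (Fin n) F}
    (h : ∀ y, ∃ x, M *ᵥ x = y) : IsUnit M := by
  choose x hx using h
  refine IsUnit.of_mul_eq_one (Matrix.of fun i j => x (Pi.single j 1) i) ?_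
  ext i j
  have := congrFun (hx (Pi.single j 1)) i
  simpa [Matrix.mul_apply, Matrix.mulVec, dotProduct, Matrix.one_apply, Pi.single_apply] using this

theorem isUnit_of_vecMul_injective {M : Matrix (Fin n) (Fin n) F}
    (h : ∀ x, x ᵥ* M = 0 → x = 0) : IsUnit M := by
  have hinj : Function.Injective (Matrix.toLinearMapRight' M) := by
    rw [injective_iff_map_eq_zero]
    exact h
  have hsurj := LinearMap.injective_iff_surjective.1 hinj
  choose x hx using hsurj
  have : (Matrix.of fun i => x (Pi.single i 1)) * M = 1 := by
    ext i j
    have := congrFun (hx (Pi.single i 1)) j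
    simpa [Matrix.toLinearMapRight', Matrix.mul_apply, Matrix.vecMul, dotProduct, Matrix.one_apply,
      Pi.single_apply, eq_comm] using this
  exact IsUnit.of_mul_eq_one_right _ this

theorem eq_of_isUnit_mulVec {M : Matrix (Fin n) (Fin n) F} (hM : IsUnit M) {x y : Fin n → F}
    (h : M *ᵥ x = M *ᵥ y) : x = y := by
  obtain ⟨K, rfl⟩ := hM
  have := congrArg (fun z => K⁻¹.val *ᵥ z) h
  simpa [Matrix.mulVec_mulVec] using this

theorem matrixSimilar_iff {A B : Matrix (Fin n) (Fin n) F} :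
    MatrixSimilar A B ↔ ∃ K, IsUnit K ∧ A * K = K * B := by
  constructor
  · rintro ⟨T, rfl⟩
    exact ⟨T, T.isUnit, by simp [mul_assoc]⟩
  · rintro ⟨_, ⟨T, rfl⟩, h⟩
    exact ⟨T, by rw [← h]; simp [mul_assoc]⟩

/-! ### Monic generators -/

theorem inputMinpoly_monic (A : Matrix (Fin n) (Fin n) F) (v : Fin n → F) :
    (inputMinpoly A v).Monic :=
  (Classical.choose_spec (exists_monic_generator_input A v)).1

theorem leftEval_eq_zero_iff {A : Matrix (Fin n) (Fin n) F} {v : Fin n → F} {q : F[X]} :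
    leftEval A v q = 0 ↔ ∃ g, q = inputMinpoly A v * g :=
  Set.ext_iff.1 (Classical.choose_spec (exists_monic_generator_input A v)).2 q

theorem outputMinpoly_monic (u : Fin n → F) (A : Matrix (Fin n) (Fin n) F) :
    (outputMinpoly u A).Monic :=
  (Classical.choose_spec (exists_monic_generator_output u A)).1

theorem rightEval_eq_zero_iff {u : Fin n → F} {A : Matrix (Fin n) (Fin n) F} {q : F[X]} :
    rightEval u A q = 0 ↔ ∃ g, q = g * outputMinpoly u A :=
  Set.ext_iff.1 (Classical.choose_spec (exists_monic_generator_output u A)).2 q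

/-- Every generator of the right ideal of `(A, v)` is a constant multiple of the monic one. -/
theorem eq_inputMinpoly_mul_C {A : Matrix (Fin n) (Fin n) F} {v : Fin n → F} {h : F[X]}
    (hh : ∀ q, leftEval A v q = 0 ↔ ∃ g, q = h * g) :
    h = inputMinpoly A v * C h.leadingCoeff := by
  have hP := inputMinpoly_monic A v
  obtain ⟨b, hb⟩ := leftEval_eq_zero_iff.1 ((hh h).2 ⟨1, (mul_one h).symm⟩)
  obtain ⟨a, ha⟩ := (hh _).1 (leftEval_eq_zero_iff.2 ⟨1, (mul_one (inputMinpoly A v)).symm⟩)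
  have hba : b * a = 1 := by
    have h1 : inputMinpoly A v * (b * a) = inputMinpoly A v * 1 := by
      rw [← mul_assoc, ← hb, ← ha, mul_one]
    exact mul_left_cancel₀ hP.ne_zero h1
  have hb0 : b ≠ 0 := left_ne_zero_of_mul_eq_one hba
  have ha0 : a ≠ 0 := right_ne_zero_of_mul_eq_one hba
  have hdeg : b.natDegree = 0 := by
    have := congrArg natDegree hba
    rw [natDegree_mul hb0 ha0, natDegree_one] at this
    omega
  have hlc : h.leadingCoeff = b.leadingCoeff := by
    rw [hb, leadingCoeff_mul, hP.leadingCoeff, one_mul]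
  rw [hlc, leadingCoeff, hdeg, ← eq_C_of_natDegree_eq_zero hdeg, ← hb]

theorem eq_inputMinpoly_of_monic {A : Matrix (Fin n) (Fin n) F} {v : Fin n → F} {p : F[X]}
    (hp : p.Monic) (h : ∀ q, leftEval A v q = 0 ↔ ∃ g, q = p * g) : p = inputMinpoly A v := by
  have := eq_inputMinpoly_mul_C h
  rwa [hp.leadingCoeff, C_1, mul_one] at this

/-! ### Left evaluation -/

theorem leftEval_mul_X (A : Matrix (Fin n) (Fin n) F) (v : Fin n → F) (f : F[X]) :
    leftEval A v (f * X) = A *ᵥ leftEval A v f := by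
  funext i
  rw [← monomial_one_one_eq_X, leftEval_mul_monomial]
  simp

theorem leftEval_C (A : Matrix (Fin n) (Fin n) F) (v : Fin n → F) (c : F) (i : Fin n) :
    leftEval A v (C c) i = v i * c := by
  rw [← monomial_zero_left, leftEval_monomial]
  simp

theorem leftEval_X (A : Matrix (Fin n) (Fin n) F) (v : Fin n → F) :
    leftEval A v X = A *ᵥ v := by
  funext i
  rw [← monomial_one_one_eq_X, leftEval_monomial]
  simp

theorem leftEval_zero_vec (A : Matrix (Fin n) (Fin n) F) (f : F[X]) :
    leftEval A 0 f = 0 := by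
  funext i
  simp [leftEval, Polynomial.sum_def]

theorem leftEval_mul (A : Matrix (Fin n) (Fin n) F) (v : Fin n → F) (p q : F[X]) :
    leftEval A v (p * q) = leftEval A (leftEval A v p) q := by
  induction q using Polynomial.induction_on' with
  | add a b ha hb => rw [mul_add, leftEval_add, leftEval_add, ha, hb]
  | monomial k c =>
    funext i
    rw [leftEval_mul_monomial, leftEval_monomial]

theorem leftEval_apply_of_natDegree_lt (A : Matrix (Fin n) (Fin n) F) (v : Fin n → F) {f : F[X]}
    {N : ℕ} (hf : f.natDegree < N) (i : Fin n) :
    leftEval A v f i = ∑ j : Fin N, ((A ^ (j : ℕ)) *ᵥ v) i * f.coeff j := by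
  rw [leftEval, f.sum_over_range' (by simp) N hf, ← Fin.sum_univ_eq_sum_range
    (fun j => ((A ^ j) *ᵥ v) i * f.coeff j)]

/-- On polynomials of degree less than `n`, left evaluation is multiplication of the coefficient
column by the controllability matrix. -/
theorem leftEval_eq_controllabilityMatrix_mulVec (A : Matrix (Fin n) (Fin n) F) (v : Fin n → F)
    {f : F[X]} (hf : f.natDegree < n) :
    leftEval A v f = controllabilityMatrix A v *ᵥ fun j => f.coeff j := by
  funext i
  rw [leftEval_apply_of_natDegree_lt A v hf]
  rfl

theorem leftEval_of_monic (A : Matrix (Fin n) (Fin n) F) (v : Fin n → F) {f : F[X]}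
    (hf : f.Monic) (hn : f.natDegree = n) :
    leftEval A v f = (controllabilityMatrix A v *ᵥ fun j => f.coeff j) + (A ^ n) *ᵥ v := by
  funext i
  rw [leftEval_apply_of_natDegree_lt A v (hn.trans_lt n.lt_succ_self), Fin.sum_univ_castSucc]
  have : f.coeff n = 1 := by rw [← hn]; exact hf
  simp [this, controllabilityMatrix, Matrix.mulVec, dotProduct]

/-- The columns `v, A v, …, A ^ n v` are dependent, so some nonzero polynomial of degree at most
`n` annihilates `v`. -/
theorem natDegree_inputMinpoly_le (A : Matrix (Fin n) (Fin n) F) (v : Fin n → F) :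
    (inputMinpoly A v).natDegree ≤ n := by
  have hdep : ¬ LinearIndependent Fᵐᵒᵖ
      (fun j : Fin (n + 1) => fun i : Fin n => op (((A ^ (j : ℕ)) *ᵥ v) i)) := by
    intro h
    have := h.fintype_card_le_finrank
    simp at this
  obtain ⟨g, hg, j, hj⟩ := Fintype.not_linearIndependent_iff.1 hdep
  set q : F[X] := ∑ k : Fin (n + 1), monomial (k : ℕ) (g k).unop with hq
  have hcoeff : ∀ k : Fin (n + 1), q.coeff k = (g k).unop := by
    intro k
    simp [hq, finsetSum_coeff, coeff_monomial, Fin.val_inj]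
  have hdeg : q.natDegree ≤ n :=
    natDegree_sum_le_of_forall_le _ _ fun k _ =>
      (natDegree_monomial_le _).trans (Nat.lt_succ_iff.1 k.2)
  have hq0 : q ≠ 0 := by
    intro h
    apply hj
    have := hcoeff j
    rw [h, coeff_zero] at this
    exact unop_injective this.symm
  have hz : leftEval A v q = 0 := by
    funext i
    rw [leftEval_apply_of_natDegree_lt A v (Nat.lt_succ_of_le hdeg)]
    have := congrArg unop (congrFun hg i)
    simp only [hcoeff]
    simpa using this
  obtain ⟨b, hb⟩ := leftEval_eq_zero_iff.1 hz
  have hb0 : b ≠ 0 := by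
    rintro rfl
    exact hq0 (by rw [hb, mul_zero])
  rw [hb, natDegree_mul (inputMinpoly_monic A v).ne_zero hb0] at hdeg
  omega

/-! ### Cyclic vectors and companion matrices -/

theorem natDegree_inputMinpoly {A : Matrix (Fin n) (Fin n) F} {v : Fin n → F}
    (h : IsControllable A v) : (inputMinpoly A v).natDegree = n := by
  refine le_antisymm (natDegree_inputMinpoly_le A v) (not_lt.1 fun hlt => ?_)
  have h0 : leftEval A v (inputMinpoly A v) = 0 :=
    leftEval_eq_zero_iff.2 ⟨1, (mul_one _).symm⟩
  rw [leftEval_eq_controllabilityMatrix_mulVec A v hlt,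
    ← Matrix.mulVec_zero (controllabilityMatrix A v)] at h0
  have := congrFun (eq_of_isUnit_mulVec h h0) ⟨_, hlt⟩
  exact one_ne_zero ((inputMinpoly_monic A v).symm.trans this)

theorem eq_inputMinpoly_of_leftEval_eq_zero {A : Matrix (Fin n) (Fin n) F} {v : Fin n → F}
    (h : IsControllable A v) {f : F[X]} (hf : f.Monic) (hn : f.natDegree = n)
    (h0 : leftEval A v f = 0) : f = inputMinpoly A v := by
  obtain ⟨g, hg⟩ := leftEval_eq_zero_iff.1 h0
  have hP := inputMinpoly_monic A v
  have hg1 : g.leadingCoeff = 1 := by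
    have := congrArg leadingCoeff hg
    rwa [leadingCoeff_mul, hf.leadingCoeff, hP.leadingCoeff, one_mul, eq_comm] at this
  have hg0 : g ≠ 0 := by
    rintro rfl
    simp at hg1
  have hd : g.natDegree = 0 := by
    have := congrArg natDegree hg
    rw [natDegree_mul hP.ne_zero hg0, natDegree_inputMinpoly h, hn] at this
    omega
  have hone : g = 1 := by
    rw [eq_C_of_natDegree_eq_zero hd, ← C_1, ← hg1, leadingCoeff, hd]
  rw [hg, hone, mul_one]

theorem mul_leftCompanion_apply (K : Matrix (Fin n) (Fin n) F) (f : F[X]) (i j : Fin n) :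
    (K * leftCompanion n f) i j =
      if h : (j : ℕ) + 1 < n then K i ⟨j + 1, h⟩ else -(K *ᵥ fun k => f.coeff k) i := by
  rw [Matrix.mul_apply]
  split_ifs with h
  · rw [Finset.sum_eq_single ⟨j + 1, h⟩]
    · simp [leftCompanion, h.ne]
    · intro b _ hb
      have : ¬ (b : ℕ) = j + 1 := fun e => hb (Fin.ext e)
      simp [leftCompanion, h.ne, this]
    · simp
  · have : (j : ℕ) + 1 = n := by omega
    simp [leftCompanion, this, Matrix.mulVec, dotProduct]

/-- `A` shifts the columns of the controllability matrix, and a monic polynomial of degree `n`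
annihilating `v` expresses the image `A ^ n v` of the last one through them. -/
theorem mul_controllabilityMatrix {A : Matrix (Fin n) (Fin n) F} {v : Fin n → F} {f : F[X]}
    (hf : f.Monic) (hn : f.natDegree = n) (h0 : leftEval A v f = 0) :
    A * controllabilityMatrix A v = controllabilityMatrix A v * leftCompanion n f := by
  ext i j
  have hcol : (A * controllabilityMatrix A v) i j = ((A ^ ((j : ℕ) + 1)) *ᵥ v) i := by
    rw [pow_succ', ← Matrix.mulVec_mulVec]
    rfl
  rw [hcol, mul_leftCompanion_apply]
  split_ifs with h
  · rfl
  · have hj : (j : ℕ) + 1 = n := by omega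
    rw [leftEval_of_monic A v hf hn] at h0
    rw [hj]
    exact (neg_eq_of_add_eq_zero_right (congrFun h0 i)).symm

theorem controllabilityMatrix_of_mul_eq [NeZero n] {A K : Matrix (Fin n) (Fin n) F} {f : F[X]}
    (h : A * K = K * leftCompanion n f) :
    controllabilityMatrix A (K *ᵥ Pi.single 0 1) = K := by
  have key : ∀ k (hk : k < n), (A ^ k) *ᵥ (K *ᵥ Pi.single 0 1) = fun i => K i ⟨k, hk⟩ := by
    intro k
    induction k with
    | zero =>
      intro hk
      rw [pow_zero, Matrix.one_mulVec, Matrix.mulVec_single_one]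
      rfl
    | succ k ih =>
      intro hk
      rw [pow_succ', ← Matrix.mulVec_mulVec, ih (by omega)]
      funext i
      have := congrFun (congrFun h i) ⟨k, by omega⟩
      rw [mul_leftCompanion_apply, dif_pos hk] at this
      exact this
  ext i j
  exact congrFun (key j j.2) i

/-- A similarity of `A` with a companion matrix is the controllability matrix of its own first
column, and the polynomial is then the minimal polynomial of that column. -/
theorem isControllable_of_mul_eq [NeZero n] {A K : Matrix (Fin n) (Fin n) F} (hK : IsUnit K)
    {f : F[X]} (hf : f.Monic) (hn : f.natDegree = n) (h : A * K = K * leftCompanion n f) :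
    IsControllable A (K *ᵥ Pi.single 0 1) ∧ f = inputMinpoly A (K *ᵥ Pi.single 0 1) := by
  have hc := controllabilityMatrix_of_mul_eq h
  have hctrl : IsControllable A (K *ᵥ Pi.single 0 1) := by
    rw [IsControllable, hc]
    exact hK
  refine ⟨hctrl, eq_inputMinpoly_of_leftEval_eq_zero hctrl hf hn ?_⟩
  have hpos := NeZero.pos n
  have hlast : (A ^ n) *ᵥ (K *ᵥ Pi.single 0 1) = -(K *ᵥ fun k => f.coeff k) := by
    obtain ⟨m, rfl⟩ : ∃ m, n = m + 1 := ⟨n - 1, by omega⟩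
    funext i
    have h1 := congrFun (congrFun h i) (Fin.last m)
    rw [mul_leftCompanion_apply, dif_neg (by simp)] at h1
    rw [Pi.neg_apply, ← h1, pow_succ', ← Matrix.mulVec_mulVec]
    conv_rhs => rw [← hc]
    rfl
  rw [leftEval_of_monic _ _ hf hn, hc, hlast, add_neg_cancel]

theorem mul_controllabilityMatrix_inputMinpoly {A : Matrix (Fin n) (Fin n) F} {v : Fin n → F}
    (h : IsControllable A v) :
    A * controllabilityMatrix A v =
      controllabilityMatrix A v * leftCompanion n (inputMinpoly A v) :=
  mul_controllabilityMatrix (inputMinpoly_monic A v) (natDegree_inputMinpoly h)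
    (leftEval_eq_zero_iff.2 ⟨1, (mul_one _).symm⟩)

/-! ### Duality with the opposite division ring -/

/-- The transpose of `M`, with entries in the opposite ring: an anti-isomorphism that turns rows
over `F` into columns over `Fᵐᵒᵖ`. -/
def transposeOp {R : Type*} (M : Matrix (Fin n) (Fin n) R) : Matrix (Fin n) (Fin n) Rᵐᵒᵖ :=
  Matrix.of fun i j => op (M j i)

theorem transposeOp_injective {R : Type*} :
    Function.Injective (transposeOp : Matrix (Fin n) (Fin n) R → Matrix (Fin n) (Fin n) Rᵐᵒᵖ) := by
  intro M N h
  ext i j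
  exact op_injective (congrFun (congrFun h j) i)

theorem transposeOp_mul (M N : Matrix (Fin n) (Fin n) F) :
    transposeOp (M * N) = transposeOp N * transposeOp M := by
  ext i j
  simp [transposeOp, Matrix.mul_apply]

theorem transposeOp_one : transposeOp (1 : Matrix (Fin n) (Fin n) F) = 1 := by
  ext i j
  by_cases h : i = j <;> simp [transposeOp, Matrix.one_apply, h, eq_comm]

theorem transposeOp_pow (M : Matrix (Fin n) (Fin n) F) (k : ℕ) :
    transposeOp (M ^ k) = transposeOp M ^ k := by
  induction k with
  | zero => simp [transposeOp_one]
  | succ k ih => rw [pow_succ, transposeOp_mul, ih, pow_succ']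

theorem isUnit_transposeOp {M : Matrix (Fin n) (Fin n) F} :
    IsUnit (transposeOp M) ↔ IsUnit M := by
  constructor
  · rintro ⟨U, hU⟩
    refine IsUnit.of_mul_eq_one (Matrix.of fun i j => unop (U⁻¹.val j i)) ?_
    apply transposeOp_injective
    rw [transposeOp_mul, transposeOp_one, ← hU]
    exact U.inv_mul
  · rintro ⟨U, rfl⟩
    exact IsUnit.of_mul_eq_one (transposeOp U⁻¹.val)
      (by rw [← transposeOp_mul, U.inv_mul, transposeOp_one])

theorem transposeOp_mulVec (A : Matrix (Fin n) (Fin n) F) (u : Fin n → F) :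
    transposeOp A *ᵥ (fun i => op (u i)) = fun i => op ((u ᵥ* A) i) := by
  funext i
  simp [transposeOp, Matrix.mulVec, Matrix.vecMul, dotProduct]

theorem controllabilityMatrix_transposeOp (u : Fin n → F) (A : Matrix (Fin n) (Fin n) F) :
    controllabilityMatrix (transposeOp A) (fun i => op (u i)) =
      transposeOp (observabilityMatrix u A) := by
  ext i j
  rw [controllabilityMatrix, Matrix.of_apply, ← transposeOp_pow, transposeOp_mulVec]
  rfl

theorem isControllable_transposeOp {u : Fin n → F} {A : Matrix (Fin n) (Fin n) F} :
    IsControllable (transposeOp A) (fun i => op (u i)) ↔ IsObservable u A := by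
  rw [IsControllable, controllabilityMatrix_transposeOp, isUnit_transposeOp, IsObservable]

theorem leftEval_transposeOp (u : Fin n → F) (A : Matrix (Fin n) (Fin n) F) (f : F[X]) :
    leftEval (transposeOp A) (fun i => op (u i)) (opRingEquiv F (op f)) =
      fun i => op (rightEval u A f i) := by
  induction f using Polynomial.induction_on' with
  | add p q hp hq =>
    rw [op_add, map_add, leftEval_add, hp, hq, rightEval_add]
    rfl
  | monomial k c =>
    funext i
    rw [opRingEquiv_op_monomial, leftEval_monomial, rightEval_monomial, ← transposeOp_pow,
      transposeOp_mulVec, op_mul]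

theorem leftCompanion_opRingEquiv (f : F[X]) :
    leftCompanion n (opRingEquiv F (op f)) = transposeOp (rightCompanion n f) := by
  ext i j
  simp only [leftCompanion, rightCompanion, transposeOp, Matrix.of_apply, Matrix.transpose_apply,
    coeff_opRingEquiv, unop_op]
  split_ifs <;> simp

theorem monic_opRingEquiv {f : F[X]} (hf : f.Monic) : (opRingEquiv F (op f)).Monic := by
  rw [Monic, leadingCoeff_opRingEquiv, unop_op, hf.leadingCoeff, op_one]

theorem inputMinpoly_transposeOp (u : Fin n → F) (A : Matrix (Fin n) (Fin n) F) :
    inputMinpoly (transposeOp A) (fun i => op (u i)) = opRingEquiv F (op (outputMinpoly u A)) := by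
  refine (eq_inputMinpoly_of_monic (monic_opRingEquiv (outputMinpoly_monic u A)) fun q => ?_).symm
  obtain ⟨q, rfl⟩ := (opRingEquiv F).surjective q
  obtain ⟨q, rfl⟩ := op_surjective q
  rw [leftEval_transposeOp]
  have h0 : (fun i => op (rightEval u A q i)) = 0 ↔ rightEval u A q = 0 := by
    simp [funext_iff]
  rw [h0, rightEval_eq_zero_iff]
  constructor
  · rintro ⟨g, rfl⟩
    exact ⟨opRingEquiv F (op g), by rw [op_mul, map_mul]⟩
  · rintro ⟨g, hg⟩
    obtain ⟨g, rfl⟩ := (opRingEquiv F).surjective g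
    rw [← map_mul] at hg
    exact ⟨unop g, op_injective ((opRingEquiv F).injective hg)⟩

theorem natDegree_outputMinpoly {u : Fin n → F} {A : Matrix (Fin n) (Fin n) F}
    (h : IsObservable u A) : (outputMinpoly u A).natDegree = n := by
  have := natDegree_inputMinpoly (isControllable_transposeOp.2 h)
  rwa [inputMinpoly_transposeOp, natDegree_opRingEquiv, unop_op] at this

theorem observabilityMatrix_mul {u : Fin n → F} {A : Matrix (Fin n) (Fin n) F}
    (h : IsObservable u A) :
    observabilityMatrix u A * A =
      rightCompanion n (outputMinpoly u A) * observabilityMatrix u A := by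
  have := mul_controllabilityMatrix_inputMinpoly (isControllable_transposeOp.2 h)
  rw [inputMinpoly_transposeOp, leftCompanion_opRingEquiv, controllabilityMatrix_transposeOp,
    ← transposeOp_mul, ← transposeOp_mul] at this
  exact transposeOp_injective this

theorem isObservable_of_mul_eq [NeZero n] {A K : Matrix (Fin n) (Fin n) F} (hK : IsUnit K)
    {g : F[X]} (hg : g.Monic) (hn : g.natDegree = n) (h : K * A = rightCompanion n g * K) :
    IsObservable (Pi.single 0 1 ᵥ* K) A ∧ g = outputMinpoly (Pi.single 0 1 ᵥ* K) A := by
  have hv : transposeOp K *ᵥ Pi.single 0 1 = fun i => op ((Pi.single 0 1 ᵥ* K) i) := by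
    rw [← transposeOp_mulVec]
    congr 1
    funext i
    by_cases hi : i = 0
    · subst hi; simp
    · simp [hi]
  have h1 := isControllable_of_mul_eq (A := transposeOp A) (isUnit_transposeOp.2 hK)
    (monic_opRingEquiv hg) (by rw [natDegree_opRingEquiv, unop_op, hn])
    (by rw [leftCompanion_opRingEquiv, ← transposeOp_mul, ← transposeOp_mul, h])
  rw [hv, isControllable_transposeOp, inputMinpoly_transposeOp] at h1
  exact ⟨h1.1, op_injective ((opRingEquiv F).injective h1.2)⟩

/-! ### The Hankel matrix intertwining the two companion matrices -/

/-- The Hankel matrix with entries `f_(i + j + 1)`. -/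
def hankel (n : ℕ) (f : F[X]) : Matrix (Fin n) (Fin n) F :=
  Matrix.of fun i j => f.coeff (i + j + 1)

/-- For monic `f` of degree `n` the Hankel matrix is zero below the antidiagonal and one on it. -/
theorem isUnit_hankel {f : F[X]} (hf : f.Monic) (hn : f.natDegree = n) :
    IsUnit (hankel n f) := by
  apply isUnit_of_vecMul_injective
  intro x hx
  have key : ∀ k (hk : k < n), x ⟨k, hk⟩ = 0 := by
    intro k
    induction k using Nat.strong_induction_on with
    | _ k ih =>
      intro hk
      have h := congrFun hx ⟨n - 1 - k, by omega⟩
      simp only [Matrix.vecMul, dotProduct, hankel, Matrix.of_apply, Pi.zero_apply] at h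
      rw [Finset.sum_eq_single ⟨k, hk⟩] at h
      · have e : k + (n - 1 - k) + 1 = f.natDegree := by omega
        rwa [e, hf.coeff_natDegree, mul_one] at h
      · intro b _ hb
        have hbk : (b : ℕ) ≠ k := fun e => hb (Fin.ext e)
        rcases lt_or_gt_of_ne hbk with hlt | hgt
        · rw [ih b hlt b.2, zero_mul]
        · rw [coeff_eq_zero_of_natDegree_lt (by omega), mul_zero]
      · simp
  funext i
  exact key i i.2

theorem leftCompanion_apply (f : F[X]) (i k : Fin n) :
    leftCompanion n f i k =
      (if (i : ℕ) = k + 1 then 1 else 0) - if (k : ℕ) + 1 = n then f.coeff i else 0 := by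
  have := i.2
  rw [leftCompanion, Matrix.of_apply]
  split_ifs with h1 h2
  · omega
  · rw [zero_sub]
  · rw [sub_zero]
  · rw [sub_zero]

/-- Multiplying a column by the left companion matrix shifts it down and subtracts a multiple of
the coefficient column; the entries may lie in any ring `S` over `F`. -/
theorem leftCompanion_map_mulVec {S : Type*} [Ring S] (φ : F →+* S) (f : F[X]) (x : Fin n → S)
    (i : Fin n) :
    ((leftCompanion n f).map φ *ᵥ x) i =
      (if 0 < (i : ℕ) then x ⟨i - 1, by omega⟩ else 0) -
        φ (f.coeff i) * x ⟨n - 1, by have := i.2; omega⟩ := by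
  have hi := i.2
  simp only [Matrix.mulVec, dotProduct, Matrix.map_apply, leftCompanion_apply, map_sub, sub_mul,
    Finset.sum_sub_distrib]
  congr 1
  · split_ifs with h
    · rw [Finset.sum_eq_single ⟨i - 1, by omega⟩]
      · rw [if_pos (by change (i : ℕ) = i - 1 + 1; omega), map_one, one_mul]
      · intro b _ hb
        rw [if_neg fun e => hb (Fin.ext (by change (b : ℕ) = i - 1; omega)), map_zero, zero_mul]
      · simp
    · refine Finset.sum_eq_zero fun b _ => ?_
      rw [if_neg (by omega), map_zero, zero_mul]
  · rw [Finset.sum_eq_single ⟨n - 1, by omega⟩]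
    · rw [if_pos (by change n - 1 + 1 = n; omega)]
    · intro b _ hb
      rw [if_neg fun e => hb (Fin.ext (by change (b : ℕ) = n - 1; omega)), map_zero, zero_mul]
    · simp

theorem vecMul_rightCompanion (f : F[X]) (x : Fin n → F) (j : Fin n) :
    (x ᵥ* rightCompanion n f) j =
      (if 0 < (j : ℕ) then x ⟨j - 1, by omega⟩ else 0) -
        x ⟨n - 1, by have := j.2; omega⟩ * f.coeff j := by
  have hj := j.2
  simp only [Matrix.vecMul, dotProduct, rightCompanion, Matrix.transpose_apply,
    leftCompanion_apply, mul_sub, Finset.sum_sub_distrib]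
  congr 1
  · split_ifs with h
    · rw [Finset.sum_eq_single ⟨j - 1, by omega⟩]
      · rw [if_pos (by change (j : ℕ) = j - 1 + 1; omega), mul_one]
      · intro b _ hb
        rw [if_neg fun e => hb (Fin.ext (by change (b : ℕ) = j - 1; omega)), mul_zero]
      · simp
    · refine Finset.sum_eq_zero fun b _ => ?_
      rw [if_neg (by omega), mul_zero]
  · rw [Finset.sum_eq_single ⟨n - 1, by omega⟩]
    · rw [if_pos (by change n - 1 + 1 = n; omega)]
    · intro b _ hb
      rw [if_neg fun e => hb (Fin.ext (by change (b : ℕ) = n - 1; omega)), mul_zero]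
    · simp

theorem leftCompanion_mul_hankel {f : F[X]} (hf : f.Monic) (hn : f.natDegree = n) :
    leftCompanion n f * hankel n f = hankel n f * rightCompanion n f := by
  have hone : f.coeff n = 1 := by rw [← hn]; exact hf
  have hzero : ∀ k, n < k → f.coeff k = 0 := fun k hk => coeff_eq_zero_of_natDegree_lt (by omega)
  ext i j
  have hi := i.2
  have hl : (leftCompanion n f * hankel n f) i j =
      (((leftCompanion n f).map (RingHom.id F)) *ᵥ fun k => hankel n f k j) i := rfl
  have hr : (hankel n f * rightCompanion n f) i j =
      ((fun k => hankel n f i k) ᵥ* rightCompanion n f) j := rfl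
  rw [hl, hr, leftCompanion_map_mulVec, vecMul_rightCompanion]
  simp only [hankel, Matrix.of_apply, RingHom.id_apply]
  rcases Nat.eq_zero_or_pos (i : ℕ) with hi0 | hi0 <;>
    rcases Nat.eq_zero_or_pos (j : ℕ) with hj0 | hj0
  · rw [hi0, hj0, if_neg (lt_irrefl 0)]
    rw [show n - 1 + 0 + 1 = n by omega, show 0 + (n - 1) + 1 = n by omega, hone, mul_one, one_mul]
  · rw [hi0, if_neg (lt_irrefl 0), if_pos hj0, hzero (n - 1 + j + 1) (by omega),
      show 0 + (n - 1) + 1 = n by omega, hone, show 0 + ((j : ℕ) - 1) + 1 = j by omega]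
    simp
  · rw [hj0, if_neg (lt_irrefl 0), if_pos hi0, hzero (i + (n - 1) + 1) (by omega),
      show n - 1 + 0 + 1 = n by omega, hone, show (i : ℕ) - 1 + 0 + 1 = i by omega]
    simp
  · rw [if_pos hi0, if_pos hj0, hzero (i + (n - 1) + 1) (by omega),
      hzero (n - 1 + j + 1) (by omega), show (i : ℕ) - 1 + j + 1 = i + (j - 1) + 1 by omega]
    simp

/-! ### The cokernel of the pencil -/

theorem pencil_mulVec (A : Matrix (Fin n) (Fin n) F) (x : Fin n → F[X]) (i : Fin n) :
    (pencil A *ᵥ x) i = X * x i - (A.map C *ᵥ x) i := by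
  rw [pencil, Matrix.sub_mulVec, Pi.sub_apply, Matrix.mulVec_diagonal]

/-- The left evaluation at `A` of a column of polynomials, `∑ j, z ^ j x_j ↦ ∑ j, A ^ j x_j`. -/
def columnEval (A : Matrix (Fin n) (Fin n) F) (g : Fin n → F[X]) : Fin n → F :=
  ∑ k, leftEval A (Pi.single k 1) (g k)

theorem columnEval_add (A : Matrix (Fin n) (Fin n) F) (g h : Fin n → F[X]) :
    columnEval A (g + h) = columnEval A g + columnEval A h := by
  simp [columnEval, leftEval_add, Finset.sum_add_distrib]

theorem columnEval_zero (A : Matrix (Fin n) (Fin n) F) : columnEval A 0 = 0 := by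
  simp [columnEval, leftEval_zero]

theorem columnEval_sub (A : Matrix (Fin n) (Fin n) F) (g h : Fin n → F[X]) :
    columnEval A (g - h) = columnEval A g - columnEval A h := by
  rw [eq_sub_iff_add_eq, ← columnEval_add, sub_add_cancel]

theorem columnEval_sum {ι : Type*} (A : Matrix (Fin n) (Fin n) F) (s : Finset ι)
    (g : ι → Fin n → F[X]) : columnEval A (∑ k ∈ s, g k) = ∑ k ∈ s, columnEval A (g k) :=
  map_sum (⟨⟨columnEval A, columnEval_zero A⟩, columnEval_add A⟩ :
    (Fin n → F[X]) →+ (Fin n → F)) g s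

theorem columnEval_C (A : Matrix (Fin n) (Fin n) F) (y : Fin n → F) :
    columnEval A (fun i => C (y i)) = y := by
  funext i
  simp [columnEval, leftEval_C, Pi.single_apply]

theorem leftEval_add_vec (A : Matrix (Fin n) (Fin n) F) (v w : Fin n → F) (f : F[X]) :
    leftEval A (v + w) f = leftEval A v f + leftEval A w f := by
  funext i
  simp [leftEval, Polynomial.sum_def, Matrix.mulVec_add, add_mul, Finset.sum_add_distrib]

theorem leftEval_sum_vec {ι : Type*} (A : Matrix (Fin n) (Fin n) F) (s : Finset ι)
    (v : ι → Fin n → F) (f : F[X]) : leftEval A (∑ k ∈ s, v k) f = ∑ k ∈ s, leftEval A (v k) f :=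
  map_sum (⟨⟨fun v => leftEval A v f, leftEval_zero_vec A f⟩, fun v w => leftEval_add_vec A v w f⟩ :
    (Fin n → F) →+ (Fin n → F)) v s

theorem columnEval_mul (A : Matrix (Fin n) (Fin n) F) (g : Fin n → F[X]) (q : F[X]) :
    columnEval A (fun i => g i * q) = leftEval A (columnEval A g) q := by
  simp only [columnEval, leftEval_mul, leftEval_sum_vec]

theorem columnEval_mulVec (A : Matrix (Fin n) (Fin n) F) (B : Matrix (Fin n) (Fin n) F[X])
    (y : Fin n → F[X]) :
    columnEval A (B *ᵥ y) = ∑ k, leftEval A (columnEval A fun i => B i k) (y k) := by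
  have : B *ᵥ y = ∑ k, fun i => B i k * y k := by
    funext i
    simp [Matrix.mulVec, dotProduct]
  rw [this, columnEval_sum]
  simp only [columnEval_mul]

theorem columnEval_pencil_mulVec (A : Matrix (Fin n) (Fin n) F) (y : Fin n → F[X]) :
    columnEval A (pencil A *ᵥ y) = 0 := by
  rw [columnEval_mulVec]
  refine Finset.sum_eq_zero fun k _ => ?_
  have hcol : (fun i => pencil A i k) =
      (fun i => C ((Pi.single k (1 : F) : Fin n → F) i) * X) - fun i => C (A i k) := by
    funext i
    by_cases h : i = k
    · subst h; simp [pencil]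
    · simp [pencil, h]
  rw [hcol, columnEval_sub, columnEval_mul, columnEval_C, columnEval_C, leftEval_X,
    Matrix.mulVec_single_one]
  have : A.col k - (fun i => A i k) = 0 := sub_self _
  rw [this, leftEval_zero_vec]

/-- A constant column times a polynomial agrees with its evaluation modulo the image of the
pencil. -/
theorem exists_pencil_mulVec_add_leftEval (A : Matrix (Fin n) (Fin n) F) (y : Fin n → F)
    (p : F[X]) :
    ∃ q, (fun i => C (y i) * p) = pencil A *ᵥ q + fun i => C (leftEval A y p i) := by
  induction p using Polynomial.induction_on with
  | C a => exact ⟨0, by funext i; simp [leftEval_C]⟩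
  | add a b ha hb =>
    obtain ⟨q, hq⟩ := ha
    obtain ⟨r, hr⟩ := hb
    refine ⟨q + r, ?_⟩
    funext i
    have h1 := congrFun hq i
    have h2 := congrFun hr i
    simp only [Pi.add_apply] at h1 h2
    simp only [mul_add, Matrix.mulVec_add, leftEval_add, Pi.add_apply, map_add, h1, h2]
    abel
  | monomial k a ih =>
    obtain ⟨q, hq⟩ := ih
    -- `(zI - A) q + y'` times `z` is `(zI - A) (q z + y') + A y'`
    refine ⟨fun i => q i * X + C (leftEval A y (C a * X ^ k) i), ?_⟩
    rw [pow_succ, ← mul_assoc, leftEval_mul_X]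
    generalize leftEval A y (C a * X ^ k) = w at hq ⊢
    funext i
    have h1 := congrFun hq i
    have h2 : (A.map C *ᵥ fun i => q i * X + C (w i)) i =
        (A.map C *ᵥ q) i * X + C ((A *ᵥ w) i) := by
      simp [Matrix.mulVec, dotProduct, mul_add, Finset.sum_add_distrib, Finset.sum_mul, mul_assoc]
    rw [Pi.add_apply, pencil_mulVec] at h1
    rw [← mul_assoc, h1, Pi.add_apply, pencil_mulVec, h2]
    rw [add_mul, sub_mul, mul_add, ← X_mul_C, mul_assoc]
    abel

/-- The kernel of evaluation is the image of the pencil: every column of polynomials is congruent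
to its evaluation modulo that image. -/
theorem exists_pencil_mulVec_add (A : Matrix (Fin n) (Fin n) F) (g : Fin n → F[X]) :
    ∃ q, g = pencil A *ᵥ q + fun i => C (columnEval A g i) := by
  choose q hq using fun k => exists_pencil_mulVec_add_leftEval A (Pi.single k 1) (g k)
  refine ⟨∑ k, q k, ?_⟩
  have hg : g = ∑ k, fun i => C ((Pi.single k (1 : F) : Fin n → F) i) * g k := by
    funext i
    simp [Pi.single_apply, apply_ite (C : F → F[X])]
  conv_lhs => rw [hg]
  simp only [hq, Finset.sum_add_distrib, Matrix.mulVec_sum]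
  congr 1
  funext i
  simp [columnEval]

/-- If the pencil is equivalent to `diag (1, …, 1, h)`, its cokernel is generated by the class `w`
of one column, and the annihilator of `w` is the right ideal generated by `h`. -/
theorem exists_isControllable_of_equivalent [NeZero n] {A : Matrix (Fin n) (Fin n) F} {h : F[X]}
    (H : PolyMatrixEquivalent (pencil A) (diagOnesLast n h)) :
    ∃ w, IsControllable A w ∧ ∀ q, leftEval A w q = 0 ↔ ∃ g, q = h * g := by
  obtain ⟨U, V, hUV⟩ := H
  set R := U⁻¹.val with hR
  set l : Fin n := ⟨n - 1, Nat.sub_lt (NeZero.pos n) one_pos⟩ with hl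
  have hlast : ∀ i : Fin n, (i : ℕ) + 1 = n ↔ i = l := by
    intro i
    rw [Fin.ext_iff]
    have := i.2
    change _ ↔ (i : ℕ) = n - 1
    omega
  have hMV : pencil A * V.val = R * diagOnesLast n h := by
    rw [← hUV, hR, mul_assoc U.val, ← mul_assoc, Units.inv_mul, one_mul]
  have hMV' : ∀ j, (pencil A *ᵥ fun i => V.val i j) = fun i => R i j * if j = l then h else 1 := by
    intro j
    funext i
    have := congrFun (congrFun hMV i) j
    rw [diagOnesLast, Matrix.mul_diagonal] at this
    simp only [hlast] at this
    exact this
  set w := columnEval A fun i => R i l with hw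
  have hother : ∀ j, j ≠ l → (columnEval A fun i => R i j) = 0 := by
    intro j hj
    have h1 := columnEval_pencil_mulVec A fun i => V.val i j
    rw [hMV' j] at h1
    simpa [hj] using h1
  have heval : ∀ x, columnEval A (R *ᵥ x) = leftEval A w (x l) := by
    intro x
    rw [columnEval_mulVec, Finset.sum_eq_single l]
    · intro j _ hj
      rw [hother j hj, leftEval_zero_vec]
    · simp
  have hsurj : ∀ y, ∃ q, leftEval A w q = y := by
    intro y
    refine ⟨(U.val *ᵥ fun i => C (y i)) l, ?_⟩
    rw [← heval, Matrix.mulVec_mulVec, hR, Units.inv_mul, Matrix.one_mulVec, columnEval_C]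
  have hann : ∀ q, leftEval A w q = 0 ↔ ∃ g, q = h * g := by
    intro q
    constructor
    · intro hq
      have h1 : columnEval A (R *ᵥ Pi.single l q) = 0 := by rw [heval, Pi.single_eq_same, hq]
      obtain ⟨y, hy⟩ := exists_pencil_mulVec_add A (R *ᵥ Pi.single l q)
      rw [h1] at hy
      have h2 : R *ᵥ Pi.single l q = pencil A *ᵥ y := by
        rw [hy]
        funext i
        simp
      have h3 : Pi.single l q = diagOnesLast n h *ᵥ (V⁻¹.val *ᵥ y) := by
        have h4 := congrArg (fun z => U.val *ᵥ z) h2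
        simp only [Matrix.mulVec_mulVec, hR, Units.mul_inv, Matrix.one_mulVec] at h4
        rw [h4, ← hUV, Matrix.mulVec_mulVec, mul_assoc, Units.mul_inv, mul_one]
      have h5 := congrFun h3 l
      rw [Pi.single_eq_same, diagOnesLast, Matrix.mulVec_diagonal, if_pos ((hlast l).2 rfl)] at h5
      exact ⟨_, h5⟩
    · rintro ⟨g, rfl⟩
      have h1 : leftEval A w h = 0 := by
        have h2 := columnEval_pencil_mulVec A fun i => V.val i l
        rw [hMV' l] at h2
        simp only [if_true] at h2
        rwa [columnEval_mul] at h2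
      rw [leftEval_mul, h1, leftEval_zero_vec]
  refine ⟨w, isUnit_of_mulVec_surjective fun y => ?_, hann⟩
  obtain ⟨q, hq⟩ := hsurj y
  -- reduce modulo the minimal polynomial to reach degree less than `n`
  set P := inputMinpoly A w
  have hP : P.Monic := inputMinpoly_monic A w
  have hdiv := modByMonic_add_div q P
  have h1 : leftEval A w (q %ₘ P) = y := by
    rw [← hq]
    conv_rhs => rw [← hdiv, leftEval_add, leftEval_eq_zero_iff.2 ⟨_, rfl⟩, add_zero]
  have h2 : (q %ₘ P).natDegree < n := by
    by_cases hz : q %ₘ P = 0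
    · rw [hz, natDegree_zero]
      exact NeZero.pos n
    · exact (natDegree_lt_natDegree hz (degree_modByMonic_lt q hP)).trans_le
        (natDegree_inputMinpoly_le A w)
  exact ⟨_, by rw [← leftEval_eq_controllabilityMatrix_mulVec A w h2, h1]⟩

/-! ### Diagonalization of the pencil of a companion matrix -/

theorem PolyMatrixEquivalent.trans {M N L : Matrix (Fin n) (Fin n) F[X]}
    (h₁ : PolyMatrixEquivalent M N) (h₂ : PolyMatrixEquivalent N L) :
    PolyMatrixEquivalent M L := by
  obtain ⟨U, V, rfl⟩ := h₁
  obtain ⟨U', V', rfl⟩ := h₂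
  exact ⟨U' * U, V * V', by simp [mul_assoc]⟩

theorem polyMatrixEquivalent_pencil_of_mul_eq {A B K : Matrix (Fin n) (Fin n) F} (hK : IsUnit K)
    (h : A * K = K * B) : PolyMatrixEquivalent (pencil A) (pencil B) := by
  obtain ⟨K, rfl⟩ := hK
  have hinv : K⁻¹.val.map C * K.val.map C = (1 : Matrix (Fin n) (Fin n) F[X]) := by
    rw [← Matrix.map_mul, Units.inv_mul, Matrix.map_one _ C_0 C_1]
  have hinv' : K.val.map C * K⁻¹.val.map C = (1 : Matrix (Fin n) (Fin n) F[X]) := by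
    rw [← Matrix.map_mul, Units.mul_inv, Matrix.map_one _ C_0 C_1]
  have hcomm : pencil A * K.val.map C = K.val.map C * pencil B := by
    have hX : Matrix.diagonal (fun _ => (X : F[X])) * K.val.map C =
        K.val.map C * Matrix.diagonal fun _ => (X : F[X]) := by
      ext1 i j
      rw [Matrix.diagonal_mul, Matrix.mul_diagonal]
      exact X_mul
    rw [pencil, pencil, sub_mul, mul_sub, hX, ← Matrix.map_mul, ← Matrix.map_mul, h]
  refine ⟨⟨K⁻¹.val.map C, K.val.map C, hinv, hinv'⟩, ⟨K.val.map C, K⁻¹.val.map C, hinv', hinv⟩, ?_⟩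
  change K⁻¹.val.map C * _ * K.val.map C = _
  rw [mul_assoc, hcomm, ← mul_assoc, hinv, one_mul]

/-- The pencil of a companion matrix with its last column replaced by the first unit vector. -/
noncomputable def shiftFactor (F : Type*) [DivisionRing F] (n : ℕ) : Matrix (Fin n) (Fin n) F[X] :=
  Matrix.of fun i j =>
    if (j : ℕ) + 1 = n then (if (i : ℕ) = 0 then 1 else 0)
    else (if i = j then X else 0) - if (i : ℕ) = j + 1 then 1 else 0

/-- The inverse of `shiftFactor`. -/
noncomputable def shiftFactorInv (F : Type*) [DivisionRing F] (n : ℕ) :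
    Matrix (Fin n) (Fin n) F[X] :=
  Matrix.of fun i k =>
    if (i : ℕ) + 1 = n then X ^ (k : ℕ)
    else if (i : ℕ) < k then -X ^ ((k : ℕ) - 1 - i) else 0

theorem mul_shiftFactor_apply (B : Matrix (Fin n) (Fin n) F[X]) (i j : Fin n) :
    (B * shiftFactor F n) i j =
      if h : (j : ℕ) + 1 < n then B i j * X - B i ⟨j + 1, h⟩ else B i ⟨0, by omega⟩ := by
  rw [Matrix.mul_apply]
  split_ifs with h
  · simp only [shiftFactor, Matrix.of_apply, if_neg h.ne, mul_sub, Finset.sum_sub_distrib]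
    congr 1
    · simp
    · rw [Finset.sum_eq_single ⟨j + 1, h⟩]
      · simp
      · intro b _ hb
        rw [if_neg fun e => hb (Fin.ext e), mul_zero]
      · simp
  · have hj : (j : ℕ) + 1 = n := by omega
    simp only [shiftFactor, Matrix.of_apply, if_pos hj]
    rw [Finset.sum_eq_single ⟨0, by omega⟩]
    · simp
    · intro b _ hb
      rw [if_neg fun e => hb (Fin.ext e), mul_zero]
    · simp

theorem shiftFactor_mul_apply (B : Matrix (Fin n) (Fin n) F[X]) (i j : Fin n) :
    (shiftFactor F n * B) i j =
      (if (i : ℕ) = 0 then B ⟨n - 1, by have := i.2; omega⟩ j else 0) +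
        ((if (i : ℕ) + 1 = n then 0 else X * B i j) -
          if 0 < (i : ℕ) then B ⟨i - 1, by omega⟩ j else 0) := by
  have hi := i.2
  have hent : ∀ k : Fin n, shiftFactor F n i k * B k j =
      (if k = ⟨n - 1, by omega⟩ then if (i : ℕ) = 0 then B k j else 0 else 0) +
        ((if k = i then if (i : ℕ) + 1 = n then 0 else X * B i j else 0) -
          if (i : ℕ) = k + 1 then B k j else 0) := by
    intro k
    have hk := k.2
    simp only [shiftFactor, Matrix.of_apply, Fin.ext_iff]
    split_ifs <;> first | omega | simp
    exact congrArg (fun l => B l j) (Fin.ext (by omega))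
  simp only [Matrix.mul_apply, hent, Finset.sum_add_distrib, Finset.sum_sub_distrib,
    Finset.sum_ite_eq', Finset.mem_univ, if_true]
  congr 2
  split_ifs with h
  · rw [Finset.sum_eq_single ⟨i - 1, by omega⟩]
    · rw [if_pos (by change (i : ℕ) = i - 1 + 1; omega)]
    · intro b _ hb
      rw [if_neg fun e => hb (Fin.ext (by change (b : ℕ) = i - 1; omega))]
    · simp
  · exact Finset.sum_eq_zero fun b _ => if_neg (by omega)

theorem shiftFactorInv_mul : shiftFactorInv F n * shiftFactor F n = 1 := by
  ext1 i j
  have hi := i.2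
  have hj := j.2
  rw [mul_shiftFactor_apply]
  simp only [shiftFactorInv, Matrix.of_apply, Matrix.one_apply, Fin.ext_iff]
  split_ifs <;> first | omega | skip
  · rw [pow_succ, sub_self]
  · rw [show (j : ℕ) + 1 - 1 - i = j - 1 - i + 1 by omega, pow_succ, neg_mul, sub_self]
  · rw [show (j : ℕ) + 1 - 1 - i = 0 by omega]
    simp
  · simp
  · exact pow_zero X
  · rfl

theorem shiftFactor_mul_inv : shiftFactor F n * shiftFactorInv F n = 1 := by
  ext1 i j
  have hi := i.2
  have hj := j.2
  rw [shiftFactor_mul_apply]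
  simp only [shiftFactorInv, Matrix.of_apply, Matrix.one_apply, Fin.ext_iff]
  split_ifs <;> first | omega | skip
  · rw [show (j : ℕ) = 0 by omega]
    simp
  · rw [show (j : ℕ) - 1 - i = j - 1 by omega, mul_neg, ← pow_succ',
      show (j : ℕ) - 1 + 1 = j by omega, sub_zero, add_neg_cancel]
  · rw [show (j : ℕ) = 0 by omega]
    simp
  · rw [show (j : ℕ) - 1 - (i - 1) = 0 by omega]
    simp
  · simp
  · rw [show (j : ℕ) - 1 - (i - 1) = j - 1 - i + 1 by omega, pow_succ']
    simp
  · rw [show (j : ℕ) - 1 - (i - 1) = 0 by omega]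
    simp
  · simp

theorem shiftFactor_mul_diagOnesLast (h : F[X]) (i j : Fin n) :
    (shiftFactor F n * diagOnesLast n h) i j =
      if (j : ℕ) + 1 = n then (if (i : ℕ) = 0 then h else 0)
      else (if i = j then X else 0) - if (i : ℕ) = j + 1 then 1 else 0 := by
  rw [diagOnesLast, Matrix.mul_diagonal]
  simp only [shiftFactor, Matrix.of_apply]
  split_ifs <;> simp

/-- The matrix whose last column is `(f_1, …, f_(n-1), 0)`, where `f_i` is `f` with its `i` lowest
coefficients shifted out; all other columns are zero. -/
noncomputable def hornerColumn (n : ℕ) (f : F[X]) : Matrix (Fin n) (Fin n) F[X] :=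
  Matrix.of fun i j =>
    if (j : ℕ) + 1 = n ∧ (i : ℕ) + 1 < n then divX^[(i : ℕ) + 1] f else 0

theorem hornerColumn_mul_self (f : F[X]) : hornerColumn n f * hornerColumn n f = 0 := by
  ext1 i j
  rw [Matrix.mul_apply]
  refine Finset.sum_eq_zero fun k _ => ?_
  simp only [hornerColumn, Matrix.of_apply]
  split_ifs <;> first | omega | simp

theorem coeff_iterate_divX (f : F[X]) (i k : ℕ) : (divX^[i] f).coeff k = f.coeff (k + i) := by
  induction i generalizing k with
  | zero => rfl
  | succ i ih => rw [Function.iterate_succ_apply', coeff_divX, ih, add_assoc, add_comm 1 i]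

theorem X_mul_iterate_divX (f : F[X]) (i : ℕ) :
    X * divX^[i + 1] f = divX^[i] f - C (f.coeff i) := by
  rw [Function.iterate_succ_apply', eq_sub_iff_add_eq, ← zero_add i, ← coeff_iterate_divX, zero_add,
    X_mul_divX_add]

theorem iterate_divX_natDegree {f : F[X]} (hf : f.Monic) : divX^[f.natDegree] f = 1 := by
  ext k
  rw [coeff_iterate_divX, coeff_one]
  split_ifs with h
  · rw [h, zero_add]
    exact hf
  · exact coeff_eq_zero_of_natDegree_lt (by omega)

/-- Horner's scheme: the pencil of the companion matrix sends `(f_1, …, f_(n-1), 1)` to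
`(f, 0, …, 0)`. -/
theorem pencil_leftCompanion_mul_hornerColumn {f : F[X]} (hf : f.Monic) (hn : f.natDegree = n) :
    pencil (leftCompanion n f) * (1 + hornerColumn n f) =
      shiftFactor F n * diagOnesLast n f := by
  have hone : divX^[n] f = 1 := by rw [← hn]; exact iterate_divX_natDegree hf
  ext1 i j
  have hi := i.2
  have hj := j.2
  rw [shiftFactor_mul_diagOnesLast]
  by_cases h : (j : ℕ) + 1 = n
  · have hx : (fun k : Fin n => (1 + hornerColumn n f) k j) =
        fun k : Fin n => divX^[(k : ℕ) + 1] f := by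
      funext k
      have hk := k.2
      by_cases hkn : (k : ℕ) + 1 = n
      · have : k = j := Fin.ext (by omega)
        simp [hornerColumn, this, h, hone]
      · have : k ≠ j := fun e => hkn (e ▸ h)
        simp [hornerColumn, this, h, show (k : ℕ) + 1 < n by omega]
    have hcol : (pencil (leftCompanion n f) * (1 + hornerColumn n f)) i j =
        (pencil (leftCompanion n f) *ᵥ fun k => (1 + hornerColumn n f) k j) i := rfl
    rw [hcol, hx, pencil_mulVec, leftCompanion_map_mulVec, X_mul_iterate_divX, if_pos h,
      show n - 1 + 1 = n by omega, hone]
    split_ifs with h0 h1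
    · omega
    · rw [show (i : ℕ) - 1 + 1 = i by omega]
      simp
    · rw [show (i : ℕ) = 0 by omega]
      simp
    · omega
  · have hcol : (pencil (leftCompanion n f) * hornerColumn n f) i j = 0 := by
      rw [Matrix.mul_apply]
      exact Finset.sum_eq_zero fun k _ => by simp [hornerColumn, h]
    rw [mul_add, mul_one, Matrix.add_apply, hcol, add_zero, if_neg h]
    simp only [pencil, Matrix.sub_apply, Matrix.diagonal_apply, Matrix.map_apply,
      leftCompanion_apply, h, if_false, sub_zero]
    split_ifs <;> simp

theorem polyMatrixEquivalent_pencil_leftCompanion {f : F[X]} (hf : f.Monic)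
    (hn : f.natDegree = n) :
    PolyMatrixEquivalent (pencil (leftCompanion n f)) (diagOnesLast n f) := by
  refine ⟨⟨shiftFactorInv F n, shiftFactor F n, shiftFactorInv_mul, shiftFactor_mul_inv⟩,
    ⟨1 + hornerColumn n f, 1 - hornerColumn n f, ?_, ?_⟩, ?_⟩
  · rw [mul_sub, mul_one, add_mul, one_mul, hornerColumn_mul_self, add_zero, add_sub_cancel_right]
  · rw [mul_add, mul_one, sub_mul, one_mul, hornerColumn_mul_self, sub_zero, sub_add_cancel]
  · change shiftFactorInv F n * _ * (1 + hornerColumn n f) = _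
    rw [mul_assoc, pencil_leftCompanion_mul_hornerColumn hf hn, ← mul_assoc, shiftFactorInv_mul,
      one_mul]

end DivisionRingCyclic

open DivisionRingCyclic
theorem mainTheorem3 {F : Type*} [DivisionRing F] {n : ℕ} [NeZero n]
    (A : Matrix (Fin n) (Fin n) F) :
    -- equivalence of the four descriptions of cyclic matrices
    List.TFAE [
      ∃ v : Fin n → F, IsControllable A v,
      ∃ u : Fin n → F, IsObservable u A,
      ∃ f : F[X], f.Monic ∧ f.natDegree = n ∧
        (MatrixSimilar A (leftCompanion n f) ∨ MatrixSimilar A (rightCompanion n f)),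
      ∃ h : F[X], PolyMatrixEquivalent (pencil A) (diagOnesLast n h)] ∧
    -- (a)
    (∀ v : Fin n → F, IsControllable A v →
      (inputMinpoly A v).natDegree = n ∧
        MatrixSimilar A (leftCompanion n (inputMinpoly A v))) ∧
    (∀ u : Fin n → F, IsObservable u A →
      (outputMinpoly u A).natDegree = n ∧
        MatrixSimilar A (rightCompanion n (outputMinpoly u A))) ∧
    -- (b)
    (∀ (T : (Matrix (Fin n) (Fin n) F)ˣ) (f : F[X]), f.Monic → f.natDegree = n →
      A = T.val * leftCompanion n f * T⁻¹.val →
        IsControllable A (T.val *ᵥ Pi.single 0 1) ∧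
          f = inputMinpoly A (T.val *ᵥ Pi.single 0 1)) ∧
    (∀ (S : (Matrix (Fin n) (Fin n) F)ˣ) (g : F[X]), g.Monic → g.natDegree = n →
      A = S.val * rightCompanion n g * S⁻¹.val →
        IsObservable (Pi.single 0 1 ᵥ* S⁻¹.val) A ∧
          g = outputMinpoly (Pi.single 0 1 ᵥ* S⁻¹.val) A) ∧
    -- (c), for an arbitrary `h` and for the monic one
    (∀ h : F[X], PolyMatrixEquivalent (pencil A) (diagOnesLast n h) →
      ∃ w : Fin n → F, IsControllable A w ∧
        h = inputMinpoly A w * C h.leadingCoeff ∧ (h.Monic → h = inputMinpoly A w)) := by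
  have ha : ∀ v : Fin n → F, IsControllable A v → (inputMinpoly A v).natDegree = n ∧
      MatrixSimilar A (leftCompanion n (inputMinpoly A v)) := fun v hv =>
    ⟨natDegree_inputMinpoly hv,
      matrixSimilar_iff.2 ⟨_, hv, mul_controllabilityMatrix_inputMinpoly hv⟩⟩
  have ha' : ∀ u : Fin n → F, IsObservable u A → (outputMinpoly u A).natDegree = n ∧
      MatrixSimilar A (rightCompanion n (outputMinpoly u A)) := by
    intro u hu
    refine ⟨natDegree_outputMinpoly hu, ?_⟩
    have hO := observabilityMatrix_mul hu
    obtain ⟨O, hO'⟩ := hu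
    rw [← hO'] at hO
    refine ⟨O⁻¹, ?_⟩
    rw [inv_inv, mul_assoc, ← hO, ← mul_assoc, Units.inv_mul, one_mul]
  have hb : ∀ (T : (Matrix (Fin n) (Fin n) F)ˣ) (f : F[X]), f.Monic → f.natDegree = n →
      A = T.val * leftCompanion n f * T⁻¹.val →
        IsControllable A (T.val *ᵥ Pi.single 0 1) ∧
          f = inputMinpoly A (T.val *ᵥ Pi.single 0 1) := by
    intro T f hf hn hA
    exact isControllable_of_mul_eq T.isUnit hf hn (by rw [hA, mul_assoc, Units.inv_mul, mul_one])
  have hb' : ∀ (S : (Matrix (Fin n) (Fin n) F)ˣ) (g : F[X]), g.Monic → g.natDegree = n →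
      A = S.val * rightCompanion n g * S⁻¹.val →
        IsObservable (Pi.single 0 1 ᵥ* S⁻¹.val) A ∧
          g = outputMinpoly (Pi.single 0 1 ᵥ* S⁻¹.val) A := by
    intro S g hg hn hA
    refine isObservable_of_mul_eq S⁻¹.isUnit hg hn ?_
    rw [hA, ← mul_assoc, ← mul_assoc, Units.inv_mul, one_mul]
  -- the Hankel matrix makes the two kinds of companion matrix of `f` similar
  have hlr : ∀ f : F[X], f.Monic → f.natDegree = n →
      (MatrixSimilar A (leftCompanion n f) ↔ MatrixSimilar A (rightCompanion n f)) := by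
    intro f hf hn
    have hH := leftCompanion_mul_hankel hf hn
    obtain ⟨H, hH'⟩ := isUnit_hankel hf hn
    rw [← hH'] at hH
    constructor
    · rintro ⟨T, hT⟩
      refine ⟨T * H, ?_⟩
      rw [hT, _root_.mul_inv_rev, Units.val_mul, Units.val_mul, mul_assoc T.val H.val, ← hH]
      simp [mul_assoc]
    · rintro ⟨T, hT⟩
      refine ⟨T * H⁻¹, ?_⟩
      rw [hT, _root_.mul_inv_rev, inv_inv, Units.val_mul, Units.val_mul, ← mul_assoc _ H.val,
        mul_assoc _ _ H.val, hH]
      simp [mul_assoc]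
  refine ⟨?_, ha, ha', hb, hb', ?_⟩
  · tfae_have 1 → 3 := fun ⟨v, hv⟩ =>
      ⟨_, inputMinpoly_monic A v, (ha v hv).1, Or.inl (ha v hv).2⟩
    tfae_have 2 → 3 := fun ⟨u, hu⟩ =>
      ⟨_, outputMinpoly_monic u A, (ha' u hu).1, Or.inr (ha' u hu).2⟩
    tfae_have 3 → 2 := by
      rintro ⟨f, hf, hn, h⟩
      obtain ⟨S, hS⟩ := h.elim (hlr f hf hn).1 id
      exact ⟨_, (hb' S f hf hn hS).1⟩
    tfae_have 3 → 4 := by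
      rintro ⟨f, hf, hn, h⟩
      obtain ⟨K, hK, hAK⟩ := matrixSimilar_iff.1 (h.elim id (hlr f hf hn).2)
      exact ⟨f, (polyMatrixEquivalent_pencil_of_mul_eq hK hAK).trans
        (polyMatrixEquivalent_pencil_leftCompanion hf hn)⟩
    tfae_have 4 → 1 := by
      rintro ⟨h, H⟩
      obtain ⟨w, hw, -⟩ := exists_isControllable_of_equivalent H
      exact ⟨w, hw⟩
    tfae_finish
  · intro h H
    obtain ⟨w, hw, hann⟩ := exists_isControllable_of_equivalent H
    exact ⟨w, hw, eq_inputMinpoly_mul_C hann, fun hm => eq_inputMinpoly_of_monic hm hann⟩
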